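/- Let $\mathsf{k}\in\mathbb N$ and let $\mathbb F_\theta^+$ be a single vertex $\mathsf{k}$-graph: the unital semigroup generated by $e^i_{\mathfrak s}$ ($1\le i\le \mathsf{k}$, $1\le \mathfrak s\le m_i$) subject to the relations $e^i_{\mathfrak s}e^j_{\mathfrak t}=e^j_{\mathfrak t'}e^i_{\mathfrak s'}$ whenever $i<j$ and $\theta_{ij}(\mathfrak s,\mathfrak t)=(\mathfrak s',\mathfrak t')$, where the $\theta_{ij}$ are permutations of $\{1,\dots,m_i\}\times\{1,\dots,m_j\}$ satisfying the cubic condition: for all $i<j<l$ the two ways of rewriting a word $e^i_{a}e^j_{b}e^l_{c}$ in the form $e^l_{c'}e^j_{b'}e^i_{a'}$ by these relations agree. Assume $m_i\ge 2$ for every $i$. Let $d:\mathbb F_\theta^+\to\mathbb N^{\mathsf{k}}$ be the degree map, with $d(e^i_{\mathfrak s})=\varepsilon_i$ (the $i$-th standard generator), and for $\mu,\nu\in\mathbb F_\theta^+$ put $$\Lambda^{\min}(\mu,\nu)=\{(\xi,\eta): \mu\xi=\nu\eta,\ d(\mu\xi)=d(\mu)\vee d(\nu)\}.$$ $\mathbb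 F_\theta^+$ has the little pull-back property if $|\Lambda^{\min}(e,f)|\le 1$ for all generators $e,f$ of distinct degrees. Let $\mathcal O_\theta$ be the universal unital C*-algebra generated by elements $s^i_{\mathfrak s}$ with $(s^i_{\mathfrak s})^*s^i_{\mathfrak t}=\delta_{\mathfrak s,\mathfrak t}I$, $\sum_{\mathfrak s}s^i_{\mathfrak s}(s^i_{\mathfrak s})^*=I$, and $s^i_{\mathfrak s}s^j_{\mathfrak t}=s^j_{\mathfrak t'}s^i_{\mathfrak s'}$ whenever $i<j$ and $\theta_{ij}(\mathfrak s,\mathfrak t)=(\mathfrak s',\mathfrak t')$; write $s_w$ for the product of generators corresponding to $w\in\mathbb F_\theta^+$. Let $$\mathcal X_0=\operatorname{span}\{s_us_v^*: u,v\in\mathbb F_\theta^+,\ d(u)=d(v)\},$$ let $\mathcal U(\mathcal X_0)$ be the group of unitaries of $\mathcal O_\theta$ lying in $\mathcal X_0$, and let $\mathsf{Ave}(\mathcal O_\theta,\mathcal U(\mathcal X_0))$ be the set of all maps $\alpha(A)=\sum_{i=1}^n\lambda_iU_iAU_i^*$ on $\mathcal O_\theta$ with $U_i\in\mathcal U(\mathcal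 X_0)$, $\lambda_i>0$ and $\sum_{i=1}^n\lambda_i=1$. Suppose that $\mathbb F_\theta^+$ has the little pull-back property. Then for each $A\in\mathcal O_\theta$, $$\overline{\{\alpha(A):\alpha\in\mathsf{Ave}(\mathcal O_\theta,\mathcal U(\mathcal X_0))\}}^{\|\cdot\|}\cap\mathbb C I\neq\varnothing .$$ -/

import Mathlib

open scoped ENNReal

noncomputable section

/-- The data defining a single vertex `k`-graph `𝔽_θ⁺`: the number `m i` of generators of each
colour `i`, and permutations `θ_{ij}` (`i < j`) satisfying the cubic condition.  Here
`θ_{ij}(s, t) = (s', t')` encodes the commutation relation `e^i_s e^j_t = e^j_{t'} e^i_{s'}`. -/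
structure SingleVertexKGraph (k : ℕ) where
  /-- `m i` is the number of generators of colour `i` -/
  m : Fin k → ℕ
  /-- the permutations `θ_{ij}` -/
  θ : ∀ ⦃i j : Fin k⦄, i < j → Equiv.Perm (Fin (m i) × Fin (m j))
  /-- The two ways of rewriting `e^i_a e^j_b e^l_c` as `e^l_* e^j_* e^i_*` agree:
  `ijl → ilj → lij → lji` on one side and `ijl → jil → jli → lji` on the other. -/
  cubic : ∀ ⦃i j l : Fin k⦄ (hij : i < j) (hjl : j < l)
    (a a₁ a₂ a₁' a₂' : Fin (m i)) (b b₁ b₂ b₁' b₂' : Fin (m j)) (c c₁ c₂ c₁' c₂' : Fin (m l)),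
    θ hjl (b, c) = (b₁, c₁) → θ (hij.trans hjl) (a, c₁) = (a₁, c₂) → θ hij (a₁, b₁) = (a₂, b₂) →
    θ hij (a, b) = (a₁', b₁') → θ (hij.trans hjl) (a₁', c) = (a₂', c₁') →
      θ hjl (b₁', c₁') = (b₂', c₂') →
    a₂ = a₂' ∧ b₂ = b₂' ∧ c₂ = c₂'

namespace SingleVertexKGraph

variable {k : ℕ} (Λ : SingleVertexKGraph k)

/-- The set of generators `e^i_s`, as formal symbols. -/
abbrev Gen : Type := Σ i : Fin k, Fin (Λ.m i)

/-- The `θ`-commutation relations. -/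
inductive Rel : FreeMonoid Λ.Gen → FreeMonoid Λ.Gen → Prop
  | comm {i j : Fin k} (h : i < j) (s s' : Fin (Λ.m i)) (t t' : Fin (Λ.m j))
      (hθ : Λ.θ h (s, t) = (s', t')) :
      Rel (FreeMonoid.of ⟨i, s⟩ * FreeMonoid.of ⟨j, t⟩)
        (FreeMonoid.of ⟨j, t'⟩ * FreeMonoid.of ⟨i, s'⟩)

/-- The unital semigroup `𝔽_θ⁺`. -/
abbrev Word : Type := PresentedMonoid Λ.Rel

/-- The generator (edge) `e^i_s` of `𝔽_θ⁺`. -/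
def e (i : Fin k) (s : Fin (Λ.m i)) : Λ.Word := PresentedMonoid.of Λ.Rel ⟨i, s⟩

/-- The degree map as a monoid homomorphism. -/
def degHom : Λ.Word →* Multiplicative (Fin k → ℕ) :=
  PresentedMonoid.lift (fun g : Λ.Gen => Multiplicative.ofAdd (Pi.single g.1 1)) (by
    rintro _ _ ⟨h, s, s', t, t', -⟩
    simp [mul_comm])

/-- The degree `d(w) ∈ ℕ^k` of `w ∈ 𝔽_θ⁺`. -/
def d (w : Λ.Word) : Fin k → ℕ := Multiplicative.toAdd (Λ.degHom w)

/-- `Λ^min(μ, ν) = {(ξ, η) : μ ξ = ν η, d(μ ξ) = d(μ) ∨ d(ν)}`. -/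
def minExt (μ ν : Λ.Word) : Set (Λ.Word × Λ.Word) :=
  {p | μ * p.1 = ν * p.2 ∧ Λ.d (μ * p.1) = Λ.d μ ⊔ Λ.d ν}

/-- The little pull-back property: `|Λ^min(e, f)| ≤ 1` whenever `e`, `f` are edges of distinct
degrees. -/
def LittlePullback : Prop :=
  ∀ (i j : Fin k), i ≠ j → ∀ (s : Fin (Λ.m i)) (t : Fin (Λ.m j)),
    (Λ.minExt (Λ.e i s) (Λ.e j t)).encard ≤ 1

/-- A Cuntz-type representation of `𝔽_θ⁺` in a unital C⋆-algebra `A`. -/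
structure CuntzRep (A : Type*) [CStarAlgebra A] where
  /-- the operators `E^i_s` -/
  E : ∀ i : Fin k, Fin (Λ.m i) → A
  star_mul_self : ∀ i s, star (E i s) * E i s = 1
  star_mul_of_ne : ∀ i s t, s ≠ t → star (E i s) * E i t = 0
  sum_mul_star : ∀ i, ∑ s, E i s * star (E i s) = 1
  comm : ∀ ⦃i j : Fin k⦄ (h : i < j) (s s' : Fin (Λ.m i)) (t t' : Fin (Λ.m j)),
    Λ.θ h (s, t) = (s', t') → E i s * E j t = E j t' * E i s'

/-- The operators `E_w`, `w ∈ 𝔽_θ⁺`, of a Cuntz-type representation `E`. -/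
def CuntzRep.word {Λ : SingleVertexKGraph k} {A : Type*} [CStarAlgebra A] (E : Λ.CuntzRep A) :
    Λ.Word →* A :=
  PresentedMonoid.lift (fun g : Λ.Gen => E.E g.1 g.2) (by
    rintro _ _ ⟨h, s, s', t, t', hθ⟩
    simpa using E.comm h s s' t t' hθ)

/-- All Cuntz-type representations of `𝔽_θ⁺` in nonzero C⋆-algebras. Since the C⋆-algebra generated
by such a representation is separable, algebras in `Type` suffice for universality. -/
structure Model where
  /-- the C⋆-algebra -/
  carrier : Type
  [cstar : CStarAlgebra carrier]
  [nontriv : Nontrivial carrier]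
  /-- the Cuntz-type representation -/
  rep : Λ.CuntzRep carrier

instance (M : Λ.Model) : CStarAlgebra M.carrier := M.cstar

instance (M : Λ.Model) : Nontrivial M.carrier := M.nontriv

/-- The C⋆-algebra of bounded families over all Cuntz-type representations. -/
abbrev BigProd : Type 1 := lp (fun M : Λ.Model => M.carrier) ∞

instance : CStarAlgebra Λ.BigProd where

/-- The direct sum, over all Cuntz-type representations, of the operators `E^i_s`. -/
def bigGen (i : Fin k) (s : Fin (Λ.m i)) : Λ.BigProd :=
  ⟨fun M => M.rep.E i s, memℓp_infty ⟨1, by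
    rintro _ ⟨M, rfl⟩
    have h := CStarRing.norm_star_mul_self (x := M.rep.E i s)
    rw [M.rep.star_mul_self, CStarRing.norm_one] at h
    change ‖M.rep.E i s‖ ≤ 1
    nlinarith [norm_nonneg (M.rep.E i s)]⟩⟩

/-- The closed ⋆-subalgebra of `BigProd` underlying `𝒪_θ`. -/
def algSub : StarSubalgebra ℂ Λ.BigProd :=
  (StarAlgebra.adjoin ℂ {x | ∃ i s, x = Λ.bigGen i s}).topologicalClosure

/-- The `k`-graph C⋆-algebra `𝒪_θ`: the universal C⋆-algebra for Cuntz-type representations of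
`𝔽_θ⁺`, i.e. the C⋆-algebra generated by the direct sum of all of them. -/
def O : Type 1 := Λ.algSub

instance : CStarAlgebra Λ.O :=
  StarSubalgebra.cstarAlgebra Λ.algSub
    (h_closed := StarSubalgebra.isClosed_topologicalClosure _)

/-- The inclusion of `𝒪_θ` in the algebra of bounded families. -/
def toBig : Λ.O →⋆ₐ[ℂ] Λ.BigProd := Λ.algSub.subtype

theorem toBig_injective : Function.Injective Λ.toBig := Subtype.val_injective

/-- The generator `s^i_t` of `𝒪_θ`. -/
def gen (i : Fin k) (t : Fin (Λ.m i)) : Λ.O :=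
  (⟨Λ.bigGen i t, StarSubalgebra.le_topologicalClosure _
    (StarAlgebra.subset_adjoin ℂ _ ⟨i, t, rfl⟩)⟩ : Λ.algSub)

theorem toBig_gen (i : Fin k) (t : Fin (Λ.m i)) : Λ.toBig (Λ.gen i t) = Λ.bigGen i t := rfl

/-- The canonical Cuntz-type representation `s` of `𝔽_θ⁺` in `𝒪_θ`. -/
def univRep : Λ.CuntzRep Λ.O where
  E := Λ.gen
  star_mul_self i s := by
    apply Λ.toBig_injective
    rw [map_mul, map_star, map_one, toBig_gen]
    ext M
    exact M.rep.star_mul_self i s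
  star_mul_of_ne i s t h := by
    apply Λ.toBig_injective
    rw [map_mul, map_star, map_zero, toBig_gen, toBig_gen]
    ext M
    exact M.rep.star_mul_of_ne i s t h
  sum_mul_star i := by
    apply Λ.toBig_injective
    rw [map_sum, map_one]
    ext M
    rw [lp.coeFn_sum, Finset.sum_apply]
    exact M.rep.sum_mul_star i
  comm i j h s s' t t' hθ := by
    apply Λ.toBig_injective
    simp only [map_mul, toBig_gen]
    ext M
    exact M.rep.comm h s s' t t' hθ

/-- Evaluation of a bounded family at one representation. -/
def evalHom (M : Λ.Model) : Λ.BigProd →⋆ₐ[ℂ] M.carrier where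
  toFun x := x M
  map_one' := rfl
  map_mul' _ _ := rfl
  map_zero' := rfl
  map_add' _ _ := rfl
  commutes' _ := rfl
  map_star' _ := rfl

/-- The universal property of `𝒪_θ`. -/
theorem existsUnique_lift (A : Type) [CStarAlgebra A] (E : Λ.CuntzRep A) :
    ∃! φ : Λ.O →⋆ₐ[ℂ] A, ∀ i s, φ (Λ.univRep.E i s) = E.E i s := by
  refine existsUnique_of_exists_of_unique ?_ ?_
  · rcases subsingleton_or_nontrivial A with h | h
    · exact ⟨{ toFun := fun _ => 0
               map_one' := Subsingleton.elim _ _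
               map_mul' := fun _ _ => Subsingleton.elim _ _
               map_zero' := Subsingleton.elim _ _
               map_add' := fun _ _ => Subsingleton.elim _ _
               commutes' := fun _ => Subsingleton.elim _ _
               map_star' := fun _ => Subsingleton.elim _ _ }, fun _ _ => Subsingleton.elim _ _⟩
    · exact ⟨(Λ.evalHom ⟨A, E⟩).comp Λ.toBig, fun _ _ => rfl⟩
  · intro φ ψ hφ hψ
    have hc : ∀ χ : Λ.O →⋆ₐ[ℂ] A, Continuous χ := fun χ =>
      (NonUnitalStarAlgHom.instContinuousLinearMapClassComplex
        (F := Λ.O →⋆ₐ[ℂ] A)).map_continuous χ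
    refine StarAlgHom.ext_topologicalClosure (S := StarAlgebra.adjoin ℂ {x | ∃ i s, x = Λ.bigGen i s})
      (hc φ) (hc ψ) ?_
    refine StarAlgHom.ext_adjoin ?_
    rintro ⟨_, hx⟩ ⟨i, s, rfl⟩
    exact (hφ i s).trans (hψ i s).symm

/-- The elements `s_w ∈ 𝒪_θ`, `w ∈ 𝔽_θ⁺`. -/
def sw (w : Λ.Word) : Λ.O := Λ.univRep.word w

/-- `𝒳_n = span {s_u s_v^* : d(u) - d(v) = n}`, the algebraic part of the `n`-th spectral subspace
of the gauge action, `n ∈ ℤ^k`. -/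
def X (n : Fin k → ℤ) : Submodule ℂ Λ.O :=
  Submodule.span ℂ {x | ∃ u v : Λ.Word, (∀ i, (Λ.d u i : ℤ) - (Λ.d v i : ℤ) = n i) ∧
    x = Λ.sw u * star (Λ.sw v)}

/-- `𝒰(𝒳₀)`: the unitaries of `𝒪_θ` that lie in `𝒳₀`. -/
def unitaryX₀ : Set (unitary Λ.O) := {U | (U : Λ.O) ∈ Λ.X 0}

end SingleVertexKGraph

/-- `Ave(A, V)`: the averaging operators `a ↦ ∑ λ_i U_i a U_i^*` with `U_i ∈ V`, `λ_i > 0`,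
`∑ λ_i = 1`. -/
def Ave (A : Type*) [CStarAlgebra A] (V : Set (unitary A)) : Set (A → A) :=
  {α | ∃ (n : ℕ) (U : Fin n → unitary A) (c : Fin n → ℝ),
    (∀ i, U i ∈ V) ∧ (∀ i, 0 < c i) ∧ ∑ i, c i = 1 ∧
    ∀ a, α a = ∑ i, (c i : ℂ) • ((U i : A) * a * star (U i : A))}

end

noncomputable section

namespace SingleVertexKGraph

variable {k : ℕ} {Λ : SingleVertexKGraph k}

/-! ### Words and degrees -/

/-! For a family $T$ of isometries with orthogonal ranges summing to $I$, let
$\Phi(A)=|T|^{-1}\sum_a T_a^*AT_a$. The map $A\mapsto\sum_b T_b\Phi(A)T_b^*$ is an average over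
signed permutation unitaries $\sum_a\pm T_{a+j}T_a^*$, which lie in $\mathcal X_0$ when the $T_a$
are words of equal degree (`dilation_compressionMean_mem_Ave`). The outer map is a unital
⋆-homomorphism, so it does not increase the distance to a scalar. Hence it suffices to bring $A$
close to the scalars by compression means.

The colour means $\Phi_i$ commute, are contractive and fix $I$. The elements that their products
move arbitrarily close to $\mathbb C I$ therefore form a closed self-adjoint subspace, and only
$s_us_v^*$ need be treated: under the pull-back property these elements span a dense ⋆-subalgebra.
If $u$ and $v$ both involve colour $i$, then $\Phi_i$ strips an edge from each, up to a scalar.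
Otherwise, up to adjoints and unless $u=v=1$, some colour $i$ occurs in $u$ but not in $v$. There
$\Phi_i$ turns $s_as_{u'}s_v^*$ into $m_i^{-1}s_{u'}s_v^*s_a$, and the pull-back property makes
$s_v^*s_a$ a single term $s_{a'}s_{v'}^*$ with $d(v')=d(v)$. The result has the same shape with a
factor at most $1/2$, so the iterates tend to $0$ (`norm_colourMean_pow_le`). A compactness argument
on the scalars finishes the proof. -/

@[simp] theorem d_one : Λ.d 1 = 0 := by simp [d]

@[simp] theorem d_mul (u v : Λ.Word) : Λ.d (u * v) = Λ.d u + Λ.d v := by simp [d]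

@[simp] theorem d_e (i : Fin k) (s : Fin (Λ.m i)) : Λ.d (Λ.e i s) = Pi.single i 1 := by
  simp [d, e, degHom, PresentedMonoid.lift_of]

@[simp] theorem word_e {A : Type*} [CStarAlgebra A] (E : Λ.CuntzRep A) (i : Fin k)
    (s : Fin (Λ.m i)) : E.word (Λ.e i s) = E.E i s := rfl

/-- Induction on words, adding one edge on the left. -/
theorem word_induction {p : Λ.Word → Prop} (one : p 1)
    (e_mul : ∀ i s w, p w → p (Λ.e i s * w)) (w : Λ.Word) : p w := by
  induction w using PresentedMonoid.inductionOn with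
  | h a =>
    induction a using FreeMonoid.inductionOn' with
    | one => rw [map_one]; exact one
    | of_mul g a ih => rw [map_mul]; exact e_mul g.1 g.2 _ ih

theorem e_mul_e_of_lt {i j : Fin k} (h : i < j) (s s' : Fin (Λ.m i)) (t t' : Fin (Λ.m j))
    (hθ : Λ.θ h (s, t) = (s', t')) : Λ.e i s * Λ.e j t = Λ.e j t' * Λ.e i s' :=
  PresentedMonoid.mk_eq_mk_of_rel (.comm h s s' t t' hθ)

/-- Edges of distinct colours can be commuted past each other. -/
theorem exists_e_mul_e {i j : Fin k} (h : i ≠ j) (s : Fin (Λ.m i)) (t : Fin (Λ.m j)) :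
    ∃ t' s', Λ.e i s * Λ.e j t = Λ.e j t' * Λ.e i s' := by
  rcases lt_or_gt_of_ne h with h | h
  · exact ⟨_, _, e_mul_e_of_lt h s _ t _ rfl⟩
  · exact ⟨((Λ.θ h).symm (t, s)).1, ((Λ.θ h).symm (t, s)).2,
      (e_mul_e_of_lt h _ _ _ _ ((Λ.θ h).apply_symm_apply (t, s))).symm⟩

/-- The relations only relate words of length two, so "equal, or both of length at least two" is a
congruence containing them, and it separates distinct edges. -/
theorem e_injective (i : Fin k) : Function.Injective (Λ.e i) := by
  intro s t hst
  let c : Con (FreeMonoid Λ.Gen) :=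
    { r := fun x y => x = y ∨ (2 ≤ x.length ∧ 2 ≤ y.length)
      iseqv := ⟨fun _ => .inl rfl, by grind, by grind⟩
      mul' := by
        rintro w x y z (rfl | h) (rfl | h')
        · exact .inl rfl
        all_goals
          right
          simp only [FreeMonoid.length_mul]
          omega }
  have hc : conGen Λ.Rel ≤ c := by
    refine Con.conGen_le.2 ?_
    rintro _ _ ⟨h, s, s', t, t', -⟩
    exact .inr (by simp [FreeMonoid.length_mul])
  have h := hc (PresentedMonoid.mk_eq_mk_iff.1 hst)
  rcases h with h | h
  · simpa using FreeMonoid.of_injective h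
  · simp at h

/-- A word whose degree has a positive `i`-th entry can be written with an edge of colour `i` in
front. -/
theorem exists_eq_e_mul (i : Fin k) (w : Λ.Word) (h : Λ.d w i ≠ 0) :
    ∃ a w', w = Λ.e i a * w' := by
  induction w using word_induction with
  | one => simp at h
  | e_mul j b w ih =>
    obtain rfl | hij := eq_or_ne i j
    · exact ⟨b, w, rfl⟩
    · obtain ⟨a, w', rfl⟩ := ih (by simpa [Pi.single_apply, hij] using h)
      obtain ⟨a', b', h'⟩ := exists_e_mul_e hij.symm b a
      exact ⟨a', Λ.e j b' * w', by rw [← mul_assoc, h', mul_assoc]⟩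

theorem eq_one_of_d_eq_zero (w : Λ.Word) (h : Λ.d w = 0) : w = 1 := by
  induction w using word_induction with
  | one => rfl
  | e_mul j b w ih => simpa [Pi.single_apply] using congrFun h j

/-! ### Products of the generators and their adjoints -/

variable {B : Type*} [CStarAlgebra B] (E : Λ.CuntzRep B)

theorem CuntzRep.star_E_mul_E (i : Fin k) (s t : Fin (Λ.m i)) :
    star (E.E i s) * E.E i t = if s = t then 1 else 0 := by
  split_ifs with h
  · rw [h, E.star_mul_self]
  · exact E.star_mul_of_ne i s t h

/-- Writing $e_se_t=e_{\tau(t)}e_{\sigma(t)}$, the pull-back property makes $\tau$ injective, hence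
a permutation of the finite set of edges of colour $j$. Exactly one $t$ then contributes to the
product. -/
theorem LittlePullback.star_E_mul_E (hΛ : Λ.LittlePullback) {i j : Fin k} (h : i ≠ j)
    (s : Fin (Λ.m i)) (t : Fin (Λ.m j)) :
    ∃ s' t', star (E.E j t) * E.E i s = E.E i s' * star (E.E j t') := by
  choose τ σ hτ using exists_e_mul_e (Λ := Λ) h s
  -- Two indices with the same image under `τ` would give two minimal common extensions of one pair
  -- of edges.
  have hinj : Function.Injective τ := by
    intro t₁ t₂ h12
    have hmem : ∀ t', τ t' = τ t₁ →
        (Λ.e j t', Λ.e i (σ t')) ∈ Λ.minExt (Λ.e i s) (Λ.e j (τ t₁)) := by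
      intro t' ht'
      refine ⟨by simpa [ht'] using hτ t', ?_⟩
      ext l
      by_cases hi : l = i
      · subst hi; simp [h]
      · by_cases hj : l = j
        · subst hj; simp [hi]
        · simp [hi, hj]
    have h' := Set.encard_le_one_iff.1 (hΛ i j h s (τ t₁)) _ _ (hmem t₁ rfl) (hmem t₂ h12.symm)
    exact e_injective j (congrArg Prod.fst h')
  obtain ⟨t', rfl⟩ := (Finite.injective_iff_surjective.1 hinj) t
  refine ⟨σ t', t', ?_⟩
  have hE : ∀ t'', E.E i s * E.E j t'' = E.E j (τ t'') * E.E i (σ t'') := fun t'' => by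
    simpa using congrArg E.word (hτ t'')
  -- Inserting $1=\sum_{t''}E_{t''}E_{t''}^*$ on the right makes the commutation relation
  -- applicable.
  calc star (E.E j (τ t')) * E.E i s
      = ∑ t'', star (E.E j (τ t')) * (E.E i s * E.E j t'') * star (E.E j t'') := by
        simp_rw [← mul_assoc, mul_assoc _ (E.E j _) (star (E.E j _)), ← Finset.mul_sum,
          E.sum_mul_star, mul_one]
    _ = ∑ t'', if t' = t'' then E.E i (σ t'') * star (E.E j t'') else 0 := by
        refine Finset.sum_congr rfl fun t'' _ => ?_
        rw [hE, ← mul_assoc, E.star_E_mul_E]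
        by_cases h : t' = t'' <;> simp [h, hinj.eq_iff]
    _ = _ := by simp

/-- Under the little pull-back property, `E_v^* E^i_a` is a single term when `v` does not involve
the colour `i`. -/
theorem LittlePullback.star_word_mul_E (hΛ : Λ.LittlePullback) (i : Fin k) (v : Λ.Word)
    (hv : Λ.d v i = 0) (a : Fin (Λ.m i)) :
    ∃ a' v', Λ.d v' = Λ.d v ∧
      star (E.word v) * E.E i a = E.E i a' * star (E.word v') := by
  induction v using word_induction generalizing a with
  | one => exact ⟨a, 1, rfl, by simp⟩
  | e_mul j b v ih =>
    have hij : i ≠ j := by rintro rfl; simp at hv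
    have hv' : Λ.d v i = 0 := by simpa [hij] using hv
    obtain ⟨a₁, b₁, h₁⟩ := hΛ.star_E_mul_E E hij a b
    obtain ⟨a₂, v₂, h₂, h₃⟩ := ih hv' a₁
    refine ⟨a₂, Λ.e j b₁ * v₂, by simp [h₂], ?_⟩
    rw [map_mul, map_mul, word_e, word_e, star_mul, star_mul, mul_assoc, h₁, ← mul_assoc, h₃,
      mul_assoc]

/-- The set of all `E_u E_v^*`, together with `0`. -/
def CuntzRep.wordProducts : Set B := {x | x = 0 ∨ ∃ u v, x = E.word u * star (E.word v)}

variable {E} in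
theorem CuntzRep.E_mul_mem_wordProducts (i : Fin k) (s : Fin (Λ.m i)) {x : B}
    (hx : x ∈ E.wordProducts) : E.E i s * x ∈ E.wordProducts := by
  rcases hx with rfl | ⟨u, v, rfl⟩
  · exact .inl (mul_zero _)
  · exact .inr ⟨Λ.e i s * u, v, by simp [mul_assoc]⟩

variable {E} in
theorem LittlePullback.star_E_mul_mem_wordProducts (hΛ : Λ.LittlePullback) (i : Fin k)
    (s : Fin (Λ.m i)) {x : B} (hx : x ∈ E.wordProducts) :
    star (E.E i s) * x ∈ E.wordProducts := by
  rcases hx with rfl | ⟨u, v, rfl⟩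
  · exact .inl (mul_zero _)
  induction u using word_induction generalizing s with
  | one => exact .inr ⟨1, v * Λ.e i s, by simp⟩
  | e_mul j t u ih =>
    rw [map_mul, word_e, mul_assoc, ← mul_assoc]
    obtain rfl | hij := eq_or_ne i j
    · rw [E.star_E_mul_E]
      split_ifs
      · exact .inr ⟨u, v, by simp⟩
      · exact .inl (by simp)
    · obtain ⟨t', s', h⟩ := hΛ.star_E_mul_E E hij.symm t s
      rw [h, mul_assoc]
      exact CuntzRep.E_mul_mem_wordProducts _ _ (ih s')

/-- Under the little pull-back property the ⋆-algebra generated by a Cuntz-type representation is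
spanned by the elements `E_u E_v^*`. -/
theorem LittlePullback.mem_span_wordProducts (hΛ : Λ.LittlePullback) {x : B}
    (hx : x ∈ StarAlgebra.adjoin ℂ {y | ∃ i s, y = E.E i s}) :
    x ∈ Submodule.span ℂ E.wordProducts := by
  rw [← StarSubalgebra.mem_toSubalgebra, StarAlgebra.adjoin_toSubalgebra,
    ← Subalgebra.mem_toSubmodule, Algebra.adjoin_eq_span] at hx
  refine Submodule.span_mono ?_ hx
  intro y hy
  induction hy using Submonoid.closure_induction_left with
  | one => exact .inr ⟨1, 1, by simp⟩
  | mul_left z hz y _ ih =>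
    rcases hz with ⟨i, s, rfl⟩ | ⟨i, s, hz⟩
    · exact CuntzRep.E_mul_mem_wordProducts i s ih
    · rw [← star_star z, hz]
      exact hΛ.star_E_mul_mem_wordProducts i s ih

end SingleVertexKGraph

/-! ### Averages over Cuntz families -/

section CuntzFamily

variable {B : Type*} [CStarAlgebra B]

/-- A finite family of isometries with orthogonal ranges summing to `1`. -/
structure IsCuntzFamily {ι : Type*} [Fintype ι] [DecidableEq ι] (T : ι → B) : Prop where
  star_mul_eq : ∀ a b, star (T a) * T b = if a = b then 1 else 0
  sum_mul_star : ∑ a, T a * star (T a) = 1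

namespace IsCuntzFamily

variable {ι κ : Type*} [Fintype ι] [DecidableEq ι] [Fintype κ] [DecidableEq κ] {T : ι → B}

theorem norm_le_one (hT : IsCuntzFamily T) (a : ι) : ‖T a‖ ≤ 1 := by
  have h := CStarRing.norm_star_mul_self (x := T a)
  rw [hT.star_mul_eq, if_pos rfl] at h
  -- The zero algebra is allowed, so the norm of the unit may be $0$.
  have h1 : ‖(1 : B)‖ ≤ 1 := by
    rcases subsingleton_or_nontrivial B with _ | _
    · rw [Subsingleton.elim (1 : B) 0, norm_zero]; exact zero_le_one
    · rw [CStarRing.norm_one]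
  nlinarith [norm_nonneg (T a)]

theorem comp_equiv (hT : IsCuntzFamily T) (e : κ ≃ ι) : IsCuntzFamily (T ∘ e) where
  star_mul_eq a b := by simp [hT.star_mul_eq]
  sum_mul_star := by rw [← hT.sum_mul_star, ← e.sum_comp]; rfl

theorem mul (hT : IsCuntzFamily T) {S : κ → B} (hS : IsCuntzFamily S) :
    IsCuntzFamily fun p : ι × κ => T p.1 * S p.2 where
  star_mul_eq := by
    rintro ⟨a, c⟩ ⟨b, d⟩
    simp only [star_mul, Prod.mk.injEq]
    rw [mul_assoc, ← mul_assoc (star (T a)), hT.star_mul_eq]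
    by_cases h : a = b <;> simp [h, hS.star_mul_eq]
  sum_mul_star := by
    rw [Fintype.sum_prod_type, ← hT.sum_mul_star]
    refine Finset.sum_congr rfl fun a _ => ?_
    simp_rw [star_mul, mul_assoc, ← mul_assoc (S _) (star (S _)), ← Finset.mul_sum,
      ← Finset.sum_mul, hS.sum_mul_star, one_mul]

end IsCuntzFamily

/-- The map `A ↦ |ι|⁻¹ ∑ T_a^* A T_a`. -/
def compressionMean {ι : Type*} [Fintype ι] (T : ι → B) : B →ₗ[ℂ] B where
  toFun A := (Fintype.card ι : ℂ)⁻¹ • ∑ a, star (T a) * A * T a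
  map_add' x y := by simp [mul_add, add_mul, Finset.sum_add_distrib]
  map_smul' c x := by
    simp only [mul_smul_comm, smul_mul_assoc, RingHom.id_apply, ← Finset.smul_sum]
    rw [smul_comm]

theorem compressionMean_apply {ι : Type*} [Fintype ι] (T : ι → B) (A : B) :
    compressionMean T A = (Fintype.card ι : ℂ)⁻¹ • ∑ a, star (T a) * A * T a := rfl

theorem star_compressionMean {ι : Type*} [Fintype ι] (T : ι → B) (A : B) :
    star (compressionMean T A) = compressionMean T (star A) := by
  simp [compressionMean_apply, star_sum, mul_assoc]

theorem compressionMean_comp_equiv {ι κ : Type*} [Fintype ι] [Fintype κ] (T : ι → B)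
    (e : κ ≃ ι) : compressionMean (T ∘ e) = compressionMean T := by
  ext A
  rw [compressionMean_apply, compressionMean_apply, Fintype.card_congr e,
    ← e.sum_comp fun a => star (T a) * A * T a]
  rfl

theorem compressionMean_compressionMean {ι κ : Type*} [Fintype ι] [Fintype κ] (T : ι → B)
    (S : κ → B) (A : B) : compressionMean S (compressionMean T A) =
      compressionMean (fun p : ι × κ => T p.1 * S p.2) A := by
  simp only [compressionMean_apply, mul_smul_comm, smul_mul_assoc, ← Finset.smul_sum, smul_smul,
    Fintype.card_prod, Nat.cast_mul, mul_inv, Fintype.sum_prod_type]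
  rw [mul_comm, Finset.sum_comm]
  simp [Finset.mul_sum, Finset.sum_mul, mul_assoc]

variable {ι : Type*} [Fintype ι] [DecidableEq ι] {T : ι → B}

theorem IsCuntzFamily.norm_compressionMean_le (hT : IsCuntzFamily T) (A : B) :
    ‖compressionMean T A‖ ≤ ‖A‖ := by
  rcases isEmpty_or_nonempty ι with _ | _
  · simp [compressionMean_apply]
  have h : ‖∑ a, star (T a) * A * T a‖ ≤ Fintype.card ι * ‖A‖ := by
    refine (norm_sum_le _ _).trans ?_
    refine (Finset.sum_le_card_nsmul _ _ ‖A‖ fun a _ => ?_).trans (by simp)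
    calc ‖star (T a) * A * T a‖ ≤ ‖star (T a)‖ * ‖A‖ * ‖T a‖ := norm_mul₃_le
      _ ≤ 1 * ‖A‖ * 1 := by
        rw [norm_star]
        gcongr <;> exact hT.norm_le_one a
      _ = ‖A‖ := by ring
  rw [compressionMean_apply, norm_smul, norm_inv, Complex.norm_natCast]
  rw [inv_mul_le_iff₀ (by exact_mod_cast Fintype.card_pos)]
  exact h

theorem IsCuntzFamily.compressionMean_one (hT : IsCuntzFamily T) [Nonempty ι] :
    compressionMean T 1 = 1 := by
  rw [compressionMean_apply]
  simp only [mul_one, hT.star_mul_eq, if_true, Finset.sum_const, Finset.card_univ]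
  rw [← Nat.cast_smul_eq_nsmul ℂ, smul_smul, inv_mul_cancel₀, one_smul]
  exact_mod_cast Fintype.card_ne_zero

/-- The ⋆-homomorphism `A ↦ ∑ T_a A T_a^*`. -/
def IsCuntzFamily.dilation (hT : IsCuntzFamily T) : B →⋆ₙₐ[ℂ] B where
  toFun A := ∑ a, T a * A * star (T a)
  map_smul' c x := by simp [Finset.smul_sum]
  map_zero' := by simp
  map_add' x y := by simp [mul_add, add_mul, Finset.sum_add_distrib]
  map_mul' x y := by
    rw [Finset.sum_mul_sum]
    refine Finset.sum_congr rfl fun a _ => ?_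
    have h : ∀ b, T a * x * star (T a) * (T b * y * star (T b)) =
        if a = b then T a * x * y * star (T b) else 0 := fun b => by
      rw [show T a * x * star (T a) * (T b * y * star (T b)) =
        T a * x * (star (T a) * T b) * y * star (T b) by simp only [mul_assoc], hT.star_mul_eq]
      split_ifs <;> simp
    simp only [h, Finset.sum_ite_eq, Finset.mem_univ, if_true]
    simp only [mul_assoc]
  map_star' x := by simp [star_sum, mul_assoc]

theorem IsCuntzFamily.dilation_apply (hT : IsCuntzFamily T) (A : B) :
    hT.dilation A = ∑ a, T a * A * star (T a) := rfl

theorem IsCuntzFamily.dilation_one (hT : IsCuntzFamily T) : hT.dilation 1 = 1 := by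
  simp [hT.dilation_apply, hT.sum_mul_star]

/-- Orthogonality of the coordinate characters on the sign group: for $a\ne b$, flipping the sign at
$a$ negates the sum. -/
theorem sum_signs_mul (a b : ι) :
    (∑ ε : ι → ℤˣ, (ε a : ℤ) * (ε b : ℤ)) = if a = b then 2 ^ Fintype.card ι else 0 := by
  split_ifs with h
  · subst h
    have : ∀ ε : ι → ℤˣ, (ε a : ℤ) * (ε a : ℤ) = 1 := fun ε => by
      rw [← Units.val_mul, Int.units_mul_self, Units.val_one]
    simp [this]
  · have h2 := Equiv.sum_comp (Equiv.mulLeft (Pi.mulSingle a (-1) : ι → ℤˣ))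
      fun ε : ι → ℤˣ => (ε a : ℤ) * (ε b : ℤ)
    simp only [Equiv.coe_mulLeft, Pi.mul_apply, Pi.mulSingle_eq_same,
      Pi.mulSingle_eq_of_ne (Ne.symm h), one_mul, Units.val_neg,
      neg_mul, Finset.sum_neg_distrib] at h2
    linarith

/-- The signed permutation unitary `∑ ε_a T_{a+j} T_a^*`. -/
def IsCuntzFamily.signedShift [AddGroup ι] (hT : IsCuntzFamily T) (j : ι) (ε : ι → ℤˣ) :
    unitary B :=
  ⟨∑ a, ((ε a : ℤ) : ℂ) • (T (a + j) * star (T a)), by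
    have hε : ∀ a, ((ε a : ℤ) : ℂ) * ((ε a : ℤ) : ℂ) = 1 := fun a => by
      rw [← Int.cast_mul, ← Units.val_mul, Int.units_mul_self, Units.val_one, Int.cast_one]
    have h1 : ∀ a b, T a * star (T (a + j)) * (T (b + j) * star (T b)) =
        if a = b then T a * star (T b) else 0 := fun a b => by
      rw [mul_assoc, ← mul_assoc (star _), hT.star_mul_eq]
      by_cases h : a = b <;> simp [h]
    have h2 : ∀ a b, T (a + j) * star (T a) * (T b * star (T (b + j))) =
        if a = b then T (a + j) * star (T (b + j)) else 0 := fun a b => by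
      rw [mul_assoc, ← mul_assoc (star _), hT.star_mul_eq]
      by_cases h : a = b <;> simp [h]
    rw [Unitary.mem_iff]
    constructor
    · simp only [star_sum, star_smul, star_mul, star_star, Finset.sum_mul_sum, smul_mul_smul_comm,
        h1, RCLike.star_def, map_intCast, smul_ite, smul_zero, Finset.sum_ite_eq,
        Finset.mem_univ, if_true, hε, one_smul]
      exact hT.sum_mul_star
    · simp only [star_sum, star_smul, star_mul, star_star, Finset.sum_mul_sum, smul_mul_smul_comm,
        h2, RCLike.star_def, map_intCast, smul_ite, smul_zero, Finset.sum_ite_eq,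
        Finset.mem_univ, if_true, hε, one_smul]
      rw [← hT.sum_mul_star]
      exact Equiv.sum_comp (Equiv.addRight j) fun a => T a * star (T a)⟩

theorem IsCuntzFamily.coe_signedShift [AddGroup ι] (hT : IsCuntzFamily T) (j : ι)
    (ε : ι → ℤˣ) : (hT.signedShift j ε : B) =
      ∑ a, ((ε a : ℤ) : ℂ) • (T (a + j) * star (T a)) := rfl

/-- Summing over signs kills the cross terms $a\ne b$. For fixed $a$, the index $a+j$ then runs over
all of `ι`, which decouples the inner compression from the outer dilation. -/
theorem IsCuntzFamily.sum_signedShift [AddGroup ι] (hT : IsCuntzFamily T) (A : B) :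
    ∑ j, ∑ ε, (hT.signedShift j ε : B) * A * star (hT.signedShift j ε : B) =
      (2 ^ Fintype.card ι : ℂ) • ∑ j, T j * (∑ a, star (T a) * A * T a) * star (T j) := by
  have h : ∀ (j : ι) (ε : ι → ℤˣ),
      (hT.signedShift j ε : B) * A * star (hT.signedShift j ε : B) =
        ∑ a, ∑ b, (((ε a : ℤ) * (ε b : ℤ) : ℤ) : ℂ) •
          (T (a + j) * (star (T a) * A * T b) * star (T (b + j))) := fun j ε => by
    simp only [coe_signedShift, star_sum, star_smul, star_mul, star_star, Finset.sum_mul,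
      Finset.mul_sum, RCLike.star_def, map_intCast]
    rw [Finset.sum_comm]
    refine Finset.sum_congr rfl fun a _ => Finset.sum_congr rfl fun b _ => ?_
    simp only [smul_mul_assoc, mul_smul_comm, smul_smul, Int.cast_mul, mul_assoc]
    rw [mul_comm ((ε a : ℤ) : ℂ)]
  have h' : ∀ j : ι, ∑ ε, (hT.signedShift j ε : B) * A * star (hT.signedShift j ε : B) =
      (2 ^ Fintype.card ι : ℂ) • ∑ a, T (a + j) * (star (T a) * A * T a) * star (T (a + j)) :=
    fun j => by
    simp_rw [h]
    rw [Finset.sum_comm, Finset.smul_sum]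
    refine Finset.sum_congr rfl fun a _ => ?_
    rw [Finset.sum_comm]
    simp_rw [← Finset.sum_smul, ← Int.cast_sum, sum_signs_mul]
    simp
  simp_rw [h', ← Finset.smul_sum]
  congr 1
  rw [Finset.sum_comm]
  simp_rw [Finset.mul_sum, Finset.sum_mul]
  rw [Finset.sum_comm (γ := ι) (α := ι) (s := Finset.univ) (t := Finset.univ)
    (f := fun j a => T j * (star (T a) * A * T a) * star (T j))]
  exact Finset.sum_congr rfl fun a _ =>
    Equiv.sum_comp (Equiv.addLeft a) fun j => T j * (star (T a) * A * T a) * star (T j)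

theorem mem_Ave_of_fintype {V : Set (unitary B)} {κ : Type*} [Fintype κ] (U : κ → unitary B)
    (c : κ → ℝ) (hU : ∀ x, U x ∈ V) (hc : ∀ x, 0 < c x) (hsum : ∑ x, c x = 1) :
    (fun A => ∑ x, (c x : ℂ) • ((U x : B) * A * star (U x : B))) ∈ Ave B V := by
  let e := (Fintype.equivFin κ).symm
  refine ⟨Fintype.card κ, U ∘ e, c ∘ e, fun _ => hU _, fun _ => hc _, ?_, fun A => ?_⟩
  · rw [← hsum]; exact e.sum_comp c
  · exact (e.sum_comp fun x => (c x : ℂ) • ((U x : B) * A * star (U x : B))).symm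

/-- `A ↦ ∑ T_b (|ι|⁻¹ ∑ T_a^* A T_a) T_b^*` is an average over signed permutation unitaries. -/
theorem IsCuntzFamily.dilation_compressionMean_mem_Ave [Nonempty ι] (hT : IsCuntzFamily T)
    {V : Set (unitary B)}
    (hV : ∀ U : unitary B, (U : B) ∈ Submodule.span ℂ {x | ∃ a b, x = T a * star (T b)} → U ∈ V) :
    (fun A => hT.dilation (compressionMean T A)) ∈ Ave B V := by
  let e := (Fintype.equivFin ι).symm
  -- Transporting the index set to a nonempty `Fin` supplies the cyclic group needed for the shifts.
  have : NeZero (Fintype.card ι) := ⟨Fintype.card_ne_zero⟩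
  have hS := hT.comp_equiv e
  have h := mem_Ave_of_fintype (V := V)
    (fun p : Fin (Fintype.card ι) × (Fin (Fintype.card ι) → ℤˣ) => hS.signedShift p.1 p.2)
    -- Uniform weights: there are $|\iota|$ shifts and $2^{|\iota|}$ sign choices.
    (fun _ => ((Fintype.card ι : ℝ) * 2 ^ Fintype.card ι)⁻¹)
    (fun p => hV _ (by
      rw [hS.coe_signedShift]
      exact Submodule.sum_mem _ fun a _ => Submodule.smul_mem _ _
        (Submodule.subset_span ⟨e (a + p.1), e a, rfl⟩)))
    (fun _ => inv_pos.2 (mul_pos (by exact_mod_cast Fintype.card_pos) (by positivity)))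
    (by
      rw [Finset.sum_const, Finset.card_univ, Fintype.card_prod, nsmul_eq_mul]
      simp only [Fintype.card_fin, Fintype.card_pi, Fintype.card_units_int, Finset.prod_const,
        Finset.card_univ, Nat.cast_mul, Nat.cast_pow, Nat.cast_ofNat]
      exact mul_inv_cancel₀ (mul_ne_zero (by exact_mod_cast Fintype.card_ne_zero) (by positivity)))
  convert h using 2 with A
  rw [← Finset.smul_sum, Fintype.sum_prod_type, hS.sum_signedShift, smul_smul,
    ← compressionMean_comp_equiv T e, compressionMean_apply, map_smul, hT.dilation_apply,
    ← e.sum_comp]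
  simp only [Fintype.card_fin, Function.comp_apply]
  congr 1
  push_cast
  field_simp

end CuntzFamily

namespace SingleVertexKGraph

variable {k : ℕ} {Λ : SingleVertexKGraph k}

/-! ### Compression means over words -/

theorem CuntzRep.isCuntzFamily {B : Type*} [CStarAlgebra B] (E : Λ.CuntzRep B) (i : Fin k) :
    IsCuntzFamily (E.E i) where
  star_mul_eq := E.star_E_mul_E i
  sum_mul_star := E.sum_mul_star i

@[simp] theorem sw_one : Λ.sw 1 = 1 := map_one _

@[simp] theorem sw_mul (u v : Λ.Word) : Λ.sw (u * v) = Λ.sw u * Λ.sw v := map_mul _ _ _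

theorem sw_e (i : Fin k) (s : Fin (Λ.m i)) : Λ.sw (Λ.e i s) = Λ.univRep.E i s := rfl

variable (Λ) in
/-- The map `A ↦ m_i⁻¹ ∑ (s^i_t)^* A s^i_t`. -/
def colourMean (i : Fin k) : Module.End ℂ Λ.O := compressionMean (Λ.univRep.E i)

/-- Since $\theta_{ij}$ is a bijection, the products $s^is^j$ and $s^js^i$ form the same family up
to reindexing. -/
theorem commute_colourMean (i j : Fin k) : Commute (Λ.colourMean i) (Λ.colourMean j) := by
  wlog h : i ≤ j generalizing i j
  · exact (this j i (le_of_not_ge h)).symm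
  obtain rfl | h := h.eq_or_lt
  · exact Commute.refl _
  have key : (fun p : Fin (Λ.m i) × Fin (Λ.m j) => Λ.univRep.E i p.1 * Λ.univRep.E j p.2) =
      (fun q : Fin (Λ.m j) × Fin (Λ.m i) => Λ.univRep.E j q.1 * Λ.univRep.E i q.2) ∘
        ((Λ.θ h).trans (Equiv.prodComm _ _)) :=
    funext fun p => Λ.univRep.comm h p.1 _ p.2 _ rfl
  refine LinearMap.ext fun A => ?_
  rw [Module.End.mul_apply, Module.End.mul_apply, colourMean, colourMean,
    compressionMean_compressionMean, compressionMean_compressionMean, key,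
    compressionMean_comp_equiv]

variable (Λ) in
/-- The commutative monoid of maps generated by the `colourMean i`. -/
def meanMonoid : Submonoid (Module.End ℂ Λ.O) := Submonoid.closure (Set.range Λ.colourMean)

theorem colourMean_mem_meanMonoid (i : Fin k) : Λ.colourMean i ∈ Λ.meanMonoid :=
  Submonoid.subset_closure ⟨i, rfl⟩

theorem commute_of_mem_meanMonoid {φ ψ : Module.End ℂ Λ.O} (hφ : φ ∈ Λ.meanMonoid)
    (hψ : ψ ∈ Λ.meanMonoid) : Commute φ ψ := by
  induction hφ, hψ using Submonoid.closure_induction₂ with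
  | mem x y hx hy =>
    obtain ⟨i, rfl⟩ := hx
    obtain ⟨j, rfl⟩ := hy
    exact commute_colourMean i j
  | one_left x hx => exact Commute.one_left x
  | one_right x hx => exact Commute.one_right x
  | mul_left x y z hx hy hz h₁ h₂ => exact h₁.mul_left h₂
  | mul_right x y z hx hy hz h₁ h₂ => exact h₁.mul_right h₂

/-- Every map in `meanMonoid` is the compression mean over a family of words of equal degree. -/
theorem exists_words_of_mem_meanMonoid (hm : ∀ i, 0 < Λ.m i) {φ : Module.End ℂ Λ.O}
    (hφ : φ ∈ Λ.meanMonoid) :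
    ∃ (ι : Type) (_ : Fintype ι) (_ : DecidableEq ι) (_ : Nonempty ι) (T : ι → Λ.Word),
      (∀ a b, Λ.d (T a) = Λ.d (T b)) ∧ IsCuntzFamily (fun a => Λ.sw (T a)) ∧
        φ = compressionMean fun a => Λ.sw (T a) := by
  induction hφ using Submonoid.closure_induction with
  | mem φ h =>
    obtain ⟨i, rfl⟩ := h
    have : NeZero (Λ.m i) := ⟨(hm i).ne'⟩
    exact ⟨Fin (Λ.m i), inferInstance, inferInstance, inferInstance, Λ.e i, by simp,
      Λ.univRep.isCuntzFamily i, rfl⟩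
  | one =>
    refine ⟨Unit, inferInstance, inferInstance, inferInstance, fun _ => 1, by simp,
      ⟨by simp, by simp⟩, ?_⟩
    ext A
    simp [compressionMean_apply]
  | mul φ ψ _ _ h₁ h₂ =>
    obtain ⟨ι, _, _, _, T, hT, hT', rfl⟩ := h₁
    obtain ⟨κ, _, _, _, S, hS, hS', rfl⟩ := h₂
    -- The composite applies `ψ` first, so the words of `ψ` stand on the left.
    refine ⟨κ × ι, inferInstance, inferInstance, inferInstance, fun p => S p.1 * T p.2, ?_, ?_, ?_⟩
    · rintro ⟨a, b⟩ ⟨c, d⟩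
      simp [hS a c, hT b d]
    · simpa using hS'.mul hT'
    · ext A
      rw [Module.End.mul_apply, compressionMean_compressionMean]
      simp

/-! ### Elements whose means approximate scalars -/

variable (Λ) in
/-- `A` can be moved arbitrarily close to the scalars by maps in `meanMonoid`. -/
def MeansToScalar (A : Λ.O) : Prop :=
  ∀ ε > 0, ∃ φ ∈ Λ.meanMonoid, ∃ c : ℂ, ‖φ A - c • 1‖ < ε

section

variable (hm : ∀ i, 0 < Λ.m i)
include hm

theorem norm_apply_le_of_mem_meanMonoid {φ : Module.End ℂ Λ.O} (hφ : φ ∈ Λ.meanMonoid)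
    (A : Λ.O) : ‖φ A‖ ≤ ‖A‖ := by
  obtain ⟨ι, _, _, _, T, -, hT, rfl⟩ := exists_words_of_mem_meanMonoid hm hφ
  exact hT.norm_compressionMean_le A

theorem apply_one_of_mem_meanMonoid {φ : Module.End ℂ Λ.O} (hφ : φ ∈ Λ.meanMonoid) :
    φ 1 = 1 := by
  obtain ⟨ι, _, _, _, T, -, hT, rfl⟩ := exists_words_of_mem_meanMonoid hm hφ
  exact hT.compressionMean_one

theorem norm_apply_sub_le_of_mem_meanMonoid {φ : Module.End ℂ Λ.O} (hφ : φ ∈ Λ.meanMonoid)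
    (A : Λ.O) (c : ℂ) : ‖φ A - c • 1‖ ≤ ‖A - c • 1‖ := by
  simpa [apply_one_of_mem_meanMonoid hm hφ] using
    norm_apply_le_of_mem_meanMonoid hm hφ (A - c • 1)

/-- The product of a mean good for $A$ and one good for $B$ is good for both: the means commute, so
each may act first on its own element, and the other then cannot increase the distance to a scalar.
-/
theorem MeansToScalar.add {A B : Λ.O} (hA : Λ.MeansToScalar A) (hB : Λ.MeansToScalar B) :
    Λ.MeansToScalar (A + B) := by
  intro ε hε
  obtain ⟨φ, hφ, c, h⟩ := hA (ε / 2) (half_pos hε)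
  obtain ⟨ψ, hψ, d, h'⟩ := hB (ε / 2) (half_pos hε)
  refine ⟨φ * ψ, mul_mem hφ hψ, c + d, ?_⟩
  have e1 := norm_apply_sub_le_of_mem_meanMonoid hm hψ (φ A) c
  have e2 := norm_apply_sub_le_of_mem_meanMonoid hm hφ (ψ B) d
  rw [← Module.End.mul_apply, ← (commute_of_mem_meanMonoid hφ hψ).eq] at e1
  calc ‖(φ * ψ) (A + B) - (c + d) • 1‖
      = ‖((φ * ψ) A - c • 1) + (φ (ψ B) - d • 1)‖ := by
        rw [map_add, add_smul, Module.End.mul_apply _ _ B]; congr 1; abel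
    _ ≤ _ := norm_add_le _ _
    _ < ε := by linarith

theorem MeansToScalar.star {A : Λ.O} (hA : Λ.MeansToScalar A) : Λ.MeansToScalar (star A) := by
  intro ε hε
  obtain ⟨φ, hφ, c, h⟩ := hA ε hε
  refine ⟨φ, hφ, starRingEnd ℂ c, ?_⟩
  obtain ⟨ι, _, _, _, T, -, hT, rfl⟩ := exists_words_of_mem_meanMonoid hm hφ
  rw [← star_compressionMean, ← norm_star]
  simpa using h

end

theorem MeansToScalar.smul {A : Λ.O} (hA : Λ.MeansToScalar A) (z : ℂ) :
    Λ.MeansToScalar (z • A) := by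
  intro ε hε
  -- The summand $1$ keeps the denominator positive when $z=0$.
  obtain ⟨φ, hφ, c, h⟩ := hA (ε / (‖z‖ + 1)) (by positivity)
  refine ⟨φ, hφ, z * c, ?_⟩
  rw [map_smul, mul_smul, ← smul_sub, norm_smul]
  rw [lt_div_iff₀ (by positivity)] at h
  nlinarith [norm_nonneg (φ A - c • 1)]

theorem MeansToScalar.of_apply {A : Λ.O} {φ : Module.End ℂ Λ.O} (hφ : φ ∈ Λ.meanMonoid)
    (h : Λ.MeansToScalar (φ A)) : Λ.MeansToScalar A := by
  intro ε hε
  obtain ⟨ψ, hψ, c, h⟩ := h ε hε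
  exact ⟨ψ * φ, mul_mem hψ hφ, c, h⟩

theorem meansToScalar_smul_one (c : ℂ) : Λ.MeansToScalar (c • 1) :=
  fun ε hε => ⟨1, one_mem _, c, by simpa using hε⟩

theorem MeansToScalar.of_approx (hm : ∀ i, 0 < Λ.m i) {A : Λ.O}
    (h : ∀ ε > 0, ∃ B, Λ.MeansToScalar B ∧ ‖A - B‖ < ε) : Λ.MeansToScalar A := by
  intro ε hε
  obtain ⟨B, hB, hAB⟩ := h (ε / 2) (half_pos hε)
  obtain ⟨φ, hφ, c, hc⟩ := hB (ε / 2) (half_pos hε)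
  refine ⟨φ, hφ, c, ?_⟩
  have h1 := norm_apply_le_of_mem_meanMonoid hm hφ (A - B)
  calc ‖φ A - c • 1‖ = ‖φ (A - B) + (φ B - c • 1)‖ := by rw [map_sub]; congr 1; abel
    _ ≤ _ := norm_add_le _ _
    _ < ε := by linarith

/-! ### Means of the spanning elements -/

theorem norm_sw_le_one (w : Λ.Word) : ‖Λ.sw w‖ ≤ 1 := by
  induction w using word_induction with
  | one =>
    rcases subsingleton_or_nontrivial Λ.O with _ | _
    · rw [Subsingleton.elim (Λ.sw 1) 0, norm_zero]; exact zero_le_one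
    · rw [sw_one, CStarRing.norm_one]
  | e_mul i s w ih =>
    rw [sw_mul, sw_e]
    exact (norm_mul_le _ _).trans
      (mul_le_one₀ ((Λ.univRep.isCuntzFamily i).norm_le_one s) (norm_nonneg _) ih)

/-- Orthogonality leaves only the term $t=a$. The leading edge is thus rotated to the right end, at
the gain of a factor $m_i^{-1}$. -/
theorem colourMean_E_mul (i : Fin k) (a : Fin (Λ.m i)) (X : Λ.O) :
    Λ.colourMean i (Λ.univRep.E i a * X) = (Λ.m i : ℂ)⁻¹ • (X * Λ.univRep.E i a) := by
  have h : ∀ t, star (Λ.univRep.E i t) * (Λ.univRep.E i a * X) * Λ.univRep.E i t =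
      if t = a then X * Λ.univRep.E i t else 0 := fun t => by
    rw [← mul_assoc, Λ.univRep.star_E_mul_E]
    split_ifs <;> simp
  rw [colourMean, compressionMean_apply, Fintype.card_fin]
  simp [h]

theorem colourMean_E_mul_star_E (i : Fin k) (a b : Fin (Λ.m i)) (X : Λ.O) :
    Λ.colourMean i (Λ.univRep.E i a * X * star (Λ.univRep.E i b)) =
      (if b = a then (Λ.m i : ℂ)⁻¹ else 0) • X := by
  rw [mul_assoc, colourMean_E_mul, mul_assoc, Λ.univRep.star_E_mul_E]
  split_ifs <;> simp

/-- If `u` involves the colour `i` and `v` does not, the means of `s_u s_v^*` decay. -/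
theorem LittlePullback.norm_colourMean_pow_le (hΛ : Λ.LittlePullback) {i : Fin k}
    (hm : 2 ≤ Λ.m i) (L : ℕ) (u v : Λ.Word) (hu : Λ.d u i ≠ 0) (hv : Λ.d v i = 0) :
    ‖(Λ.colourMean i ^ L) (Λ.sw u * star (Λ.sw v))‖ ≤ (1 / 2) ^ L := by
  induction L generalizing u v with
  | zero =>
    refine (norm_mul_le _ _).trans ?_
    rw [norm_star, pow_zero]
    exact mul_le_one₀ (norm_sw_le_one u) (norm_nonneg _) (norm_sw_le_one v)
  | succ L ih =>
    obtain ⟨a, u', rfl⟩ := exists_eq_e_mul i u hu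
    -- The rotated edge passes back through $s_v^*$ as a single edge of colour $i$, so the new left
    -- word again involves $i$ and the new right word still avoids it.
    obtain ⟨a', v', hv', h⟩ := hΛ.star_word_mul_E Λ.univRep i v hv a
    have h' : Λ.colourMean i (Λ.sw (Λ.e i a * u') * star (Λ.sw v)) =
        (Λ.m i : ℂ)⁻¹ • (Λ.sw (u' * Λ.e i a') * star (Λ.sw v')) := by
      rw [sw_mul, sw_e, mul_assoc, colourMean_E_mul, mul_assoc, sw, sw, h, sw_mul, sw_e, mul_assoc]
      rfl
    rw [pow_succ, Module.End.mul_apply, h', map_smul, norm_smul, pow_succ', norm_inv,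
      Complex.norm_natCast]
    refine mul_le_mul ?_ (ih _ _ (by simp) (by rw [hv', hv])) (norm_nonneg _) (by norm_num)
    rw [one_div]
    exact inv_anti₀ two_pos (by exact_mod_cast hm)

theorem LittlePullback.meansToScalar_of_d (hΛ : Λ.LittlePullback) (hm : ∀ i, 2 ≤ Λ.m i)
    (i : Fin k) (u v : Λ.Word) (hu : Λ.d u i ≠ 0) (hv : Λ.d v i = 0) :
    Λ.MeansToScalar (Λ.sw u * star (Λ.sw v)) := by
  intro ε hε
  obtain ⟨L, hL⟩ := exists_pow_lt_of_lt_one hε (by norm_num : (1 / 2 : ℝ) < 1)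
  refine ⟨Λ.colourMean i ^ L, pow_mem (colourMean_mem_meanMonoid i) L, 0, ?_⟩
  rw [zero_smul, sub_zero]
  exact (hΛ.norm_colourMean_pow_le (hm i) L u v hu hv).trans_lt hL

/-- Induction on the total degree of $u$: a colour common to $u$ and $v$ is stripped from both, and
a colour in only one of them gives decay, after taking adjoints if it lies in $v$. -/
theorem LittlePullback.meansToScalar_sw_mul_star (hΛ : Λ.LittlePullback) (hm : ∀ i, 2 ≤ Λ.m i)
    (u v : Λ.Word) : Λ.MeansToScalar (Λ.sw u * star (Λ.sw v)) := by
  have hm' : ∀ i, 0 < Λ.m i := fun i => two_pos.trans_le (hm i)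
  induction hn : ∑ i, Λ.d u i using Nat.strong_induction_on generalizing u v with
  | _ n ih =>
  subst hn
  by_cases hne : Λ.d u = 0 ∧ Λ.d v = 0
  · rw [eq_one_of_d_eq_zero u hne.1, eq_one_of_d_eq_zero v hne.2]
    simpa using meansToScalar_smul_one (Λ := Λ) 1
  obtain ⟨i, hi⟩ : ∃ i, ¬(Λ.d u i = 0 ∧ Λ.d v i = 0) := by
    by_contra! h
    exact hne ⟨funext fun i => (h i).1, funext fun i => (h i).2⟩
  by_cases hu : Λ.d u i = 0
  · have hv : Λ.d v i ≠ 0 := fun hv => hi ⟨hu, hv⟩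
    simpa using (hΛ.meansToScalar_of_d hm i v u hv hu).star hm'
  by_cases hv : Λ.d v i = 0
  · exact hΛ.meansToScalar_of_d hm i u v hu hv
  obtain ⟨a, u, rfl⟩ := exists_eq_e_mul i u hu
  obtain ⟨b, v, rfl⟩ := exists_eq_e_mul i v hv
  refine .of_apply (colourMean_mem_meanMonoid i) ?_
  rw [sw_mul, sw_mul, sw_e, sw_e, star_mul, mul_assoc, ← mul_assoc (Λ.sw u), ← mul_assoc,
    colourMean_E_mul_star_E]
  refine (ih _ ?_ u v rfl).smul _
  simp [Finset.sum_add_distrib]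

/-- The ⋆-algebra generated by the `s^i_t` is dense in `𝒪_θ`. -/
theorem exists_mem_adjoin_norm_sub_lt (A : Λ.O) {ε : ℝ} (hε : 0 < ε) :
    ∃ B ∈ StarAlgebra.adjoin ℂ {y | ∃ i s, y = Λ.univRep.E i s}, ‖A - B‖ < ε := by
  have hA : Λ.toBig A ∈ closure
      (StarAlgebra.adjoin ℂ {x | ∃ i s, x = Λ.bigGen i s} : Set Λ.BigProd) := A.2
  obtain ⟨b, hb, hlt⟩ := Metric.mem_closure_iff.1 hA ε hε
  have himage : {x | ∃ i s, x = Λ.bigGen i s} =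
      Λ.toBig '' {y | ∃ i s, y = Λ.univRep.E i s} := by
    ext x
    constructor
    · rintro ⟨i, s, rfl⟩
      exact ⟨_, ⟨i, s, rfl⟩, rfl⟩
    · rintro ⟨_, ⟨i, s, rfl⟩, rfl⟩
      exact ⟨i, s, rfl⟩
  rw [himage, ← StarAlgHom.map_adjoin] at hb
  obtain ⟨B, hB, rfl⟩ := hb
  refine ⟨B, hB, ?_⟩
  rw [dist_eq_norm] at hlt
  exact hlt

theorem LittlePullback.meansToScalar (hΛ : Λ.LittlePullback) (hm : ∀ i, 2 ≤ Λ.m i) (A : Λ.O) :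
    Λ.MeansToScalar A := by
  have hm' : ∀ i, 0 < Λ.m i := fun i => two_pos.trans_le (hm i)
  refine .of_approx hm' fun ε hε => ?_
  obtain ⟨B, hB, hAB⟩ := exists_mem_adjoin_norm_sub_lt A hε
  refine ⟨B, ?_, hAB⟩
  have hzero : Λ.MeansToScalar 0 := by simpa using meansToScalar_smul_one (Λ := Λ) 0
  have hspan := hΛ.mem_span_wordProducts Λ.univRep hB
  clear hB hAB
  induction hspan using Submodule.span_induction with
  | mem x hx =>
    rcases hx with rfl | ⟨u, v, rfl⟩
    · exact hzero
    · exact hΛ.meansToScalar_sw_mul_star hm u v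
  | zero => exact hzero
  | add x y _ _ hx hy => exact hx.add hm' hy
  | smul c x _ hx => exact hx.smul c

/-! ### Averages by unitaries in `𝒳₀` -/

/-- Dilating the compression mean gives an average by unitaries in $\mathcal X_0$. The dilation is a
contraction fixing scalars, so the estimate survives. -/
theorem MeansToScalar.exists_mem_Ave (hm : ∀ i, 0 < Λ.m i) {A : Λ.O} (hA : Λ.MeansToScalar A)
    {ε : ℝ} (hε : 0 < ε) : ∃ α ∈ Ave Λ.O Λ.unitaryX₀, ∃ c : ℂ, ‖α A - c • 1‖ < ε := by
  obtain ⟨φ, hφ, c, hc⟩ := hA ε hε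
  obtain ⟨ι, _, _, _, T, hd, hT, rfl⟩ := exists_words_of_mem_meanMonoid hm hφ
  refine ⟨_, hT.dilation_compressionMean_mem_Ave fun U hU => ?_, c, ?_⟩
  · refine Submodule.span_mono ?_ hU
    rintro _ ⟨a, b, rfl⟩
    exact ⟨T a, T b, fun i => by simp [hd a b], rfl⟩
  · have h := NonUnitalStarAlgHom.norm_apply_le hT.dilation
      (compressionMean (fun a => Λ.sw (T a)) A - c • 1)
    rw [map_sub, map_smul, hT.dilation_one] at h
    exact h.trans_lt hc

end SingleVertexKGraph

/-! ### From approximate scalars to a limit scalar -/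

theorem norm_apply_le_of_mem_Ave {B : Type*} [CStarAlgebra B] {V : Set (unitary B)} {α : B → B}
    (hα : α ∈ Ave B V) (A : B) : ‖α A‖ ≤ ‖A‖ := by
  obtain ⟨n, U, c, -, hc, hsum, h⟩ := hα
  rw [h]
  calc ‖∑ i, (c i : ℂ) • ((U i : B) * A * star (U i : B))‖ ≤ ∑ i, c i * ‖A‖ := by
        refine norm_sum_le_of_le _ fun i _ => ?_
        rw [norm_smul, Complex.norm_real, Real.norm_of_nonneg (hc i).le, ← Unitary.coe_star,
          CStarRing.norm_mul_coe_unitary, CStarRing.norm_coe_unitary_mul]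
    _ = ‖A‖ := by rw [← Finset.sum_mul, hsum, one_mul]

/-- If averages of `A` come arbitrarily close to the scalars, some scalar is a limit of averages. -/
theorem closure_Ave_inter_scalars_nonempty {B : Type*} [CStarAlgebra B] {V : Set (unitary B)}
    {A : B} (h : ∀ ε > 0, ∃ α ∈ Ave B V, ∃ c : ℂ, ‖α A - c • 1‖ < ε) :
    (closure {x | ∃ α ∈ Ave B V, x = α A} ∩ Set.range fun z : ℂ => z • (1 : B)).Nonempty := by
  -- In the zero algebra $\|cI\|$ does not control $|c|$, so that case is separate.
  rcases subsingleton_or_nontrivial B with _ | _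
  · obtain ⟨α, hα, -⟩ := h 1 one_pos
    exact ⟨0, subset_closure ⟨α, hα, Subsingleton.elim _ _⟩, 0, Subsingleton.elim _ _⟩
  choose α hα c hc using fun n : ℕ => h (1 / ((n : ℝ) + 1)) Nat.one_div_pos_of_nat
  -- Averages are contractive and the errors are at most $1$, so the scalars stay in a compact disc
  -- of radius $\|A\|+1$.
  have hbdd : ∀ n, c n ∈ Metric.closedBall (0 : ℂ) (‖A‖ + 1) := fun n => by
    rw [mem_closedBall_zero_iff]
    have h1 : ‖c n • (1 : B)‖ = ‖c n‖ := by rw [norm_smul, CStarRing.norm_one, mul_one]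
    have h2 : 1 / ((n : ℝ) + 1) ≤ 1 := by
      rw [div_le_one (by positivity)]
      linarith [(Nat.cast_nonneg n : (0 : ℝ) ≤ n)]
    have h3 := norm_sub_norm_le (c n • (1 : B)) (α n A)
    rw [norm_sub_rev, h1] at h3
    linarith [hc n, norm_apply_le_of_mem_Ave (hα n) A]
  obtain ⟨z, -, φ, hφ, hz⟩ := (isCompact_closedBall (0 : ℂ) (‖A‖ + 1)).tendsto_subseq hbdd
  refine ⟨z • 1, ?_, z, rfl⟩
  refine mem_closure_of_tendsto (f := fun n => α (φ n) A) (b := Filter.atTop) ?_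
    (.of_forall fun n => ⟨_, hα _, rfl⟩)
  have h1 : Filter.Tendsto (fun n => α (φ n) A - c (φ n) • (1 : B)) Filter.atTop (nhds 0) :=
    squeeze_zero_norm (fun n => (hc (φ n)).le)
      (tendsto_one_div_add_atTop_nhds_zero_nat.comp hφ.tendsto_atTop)
  simpa using h1.add (hz.smul_const (1 : B))

theorem mainTheorem4 {k : ℕ} (Λ : SingleVertexKGraph k) (hm : ∀ i, 2 ≤ Λ.m i)
    (hΛ : Λ.LittlePullback) (A : Λ.O) :
    (closure {B : Λ.O | ∃ α ∈ Ave Λ.O Λ.unitaryX₀, B = α A} ∩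
      Set.range (fun z : ℂ => z • (1 : Λ.O))).Nonempty :=
  closure_Ave_inter_scalars_nonempty fun _ hε =>
    (hΛ.meansToScalar hm A).exists_mem_Ave (fun i => two_pos.trans_le (hm i)) hε

end
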